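/- Let $\mathcal C$ be a Grothendieck category (an abelian category with a generator in which small colimits exist and filtered colimits are exact) that has a set $\{G_i\}_{i\in\Lambda}$ of finitely generated projective generators. Let $(U,\theta,\eta)$ be a monad on $\mathcal C$ whose underlying functor is exact and preserves small colimits, and let $EM_U$ be its Eilenberg–Moore category of $U$-modules $(M,f_M:UM\to M)$, which is again a Grothendieck category. Let $\delta:U\to U$ be a derivation on $U$, i.e. a natural transformation with $$\delta_X\circ\theta_X=\theta_X\circ\bigl(U(\delta_X)+\delta_{UX}\bigr)\qquad\text{for all } X\in\mathcal C .$$ Let $\tau=(\mathcal T,\mathcal F)$ be a hereditary torsion theory on $EM_U$: $\mathcal T$ and $\mathcal F$ are full subcategories closed under isomorphism, $EM_U(X,Y)=0$ for all $X\in\mathcal T$, $Y\in\mathcal F$, every $Z\in EM_U$ sits in a short exact sequence $0\to Z^{\mathcal T}\to Z\to Z^{\mathcal F}\to 0$ with $Z^{\mathcal T}\in\mathcal T$ and $Z^{\mathcal F}\in\mathcal F$, and $\mathcal T$ is closed under subobjects. For $M\in EM_U$ let $M_\tau=\sum\{N\subseteq M : N\in\mathcal T\}$ denote its torsion subobject in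 $EM_U$. Then $\tau$ is differential: for every $U$-module $(M,f_M)$ and every $\delta$-derivation $D$ on $M$, i.e. every morphism $D:M\to M$ in $\mathcal C$ with $$D\circ f_M=f_M\circ\bigl(U(D)+\delta_M\bigr),$$ one has $D(M_\tau)\subseteq M_\tau$, where $D(M_\tau)$ is the image in $\mathcal C$ of the restriction of $D$ to $M_\tau$. -/

import Mathlib

open CategoryTheory CategoryTheory.Limits

universe v u

namespace EMTorsion

section TorsionTheory

variable {D : Type u} [Category.{v} D]

/-- A torsion theory on an abelian category `D`: a pair of strict (closed under isomorphism) full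
subcategories, given by the properties of objects that define them, such that there are no nonzero
morphisms from torsion to torsion-free objects and every object is an extension
`0 ⟶ A ⟶ Z ⟶ B ⟶ 0` of a torsion-free object by a torsion object. -/
structure TorsionTheory (D : Type u) [Category.{v} D] [Abelian D] where
  /-- the torsion class -/
  torsion : ObjectProperty D
  /-- the torsion-free class -/
  torsionFree : ObjectProperty D
  torsion_iso : torsion.IsClosedUnderIsomorphisms
  torsionFree_iso : torsionFree.IsClosedUnderIsomorphisms
  hom_eq_zero : ∀ {X Y : D}, torsion X → torsionFree Y → ∀ f : X ⟶ Y, f = 0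
  exists_shortExact : ∀ Z : D, ∃ (A B : D) (i : A ⟶ Z) (p : Z ⟶ B) (w : i ≫ p = 0),
    torsion A ∧ torsionFree B ∧ (ShortComplex.mk i p w).ShortExact

/-- A torsion theory is hereditary if its torsion class is closed under subobjects. -/
def TorsionTheory.IsHereditary [Abelian D] (τ : TorsionTheory D) : Prop :=
  τ.torsion.IsClosedUnderSubobjects

/-- The torsion subobject of `M`: the sum of all subobjects of `M` that are torsion. -/
noncomputable def TorsionTheory.torsionSubobject [Abelian D] [IsGrothendieckAbelian.{v} D]
    (τ : TorsionTheory D) (M : D) : Subobject M :=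
  sSup {N : Subobject M | τ.torsion (N : D)}

/-- An object `X` of a Grothendieck category is finitely generated if, whenever `X` is the sum of
a nonempty upwards directed set of subobjects, one of these subobjects is already `X`. -/
def IsFinitelyGenerated [Abelian D] [IsGrothendieckAbelian.{v} D] (X : D) : Prop :=
  ∀ S : Set (Subobject X), S.Nonempty → DirectedOn (· ≤ ·) S → sSup S = ⊤ → ⊤ ∈ S

end TorsionTheory

section EilenbergMoore

variable {C : Type u} [Category.{v} C] [Abelian C]

/-- A left exact endofunctor of an abelian category is additive. -/
instance additive_of_leftExact (U : CategoryTheory.Monad C) [PreservesFiniteLimits U.toFunctor] :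
    U.toFunctor.Additive :=
  have : U.toFunctor.PreservesZeroMorphisms :=
    Functor.preservesZeroMorphisms_of_preserves_terminal_object
  Functor.additive_of_preserves_binary_products _

variable (U : CategoryTheory.Monad C) [PreservesFiniteLimits U.toFunctor] [PreservesFiniteColimits U.toFunctor]

/-- Modules over an exact monad on an abelian category form an abelian category. The preadditive
structure is the one of Mathlib (addition of underlying morphisms). -/
noncomputable instance abelianAlgebra : Abelian U.Algebra := by
  have : HasFiniteLimits U.Algebra :=
    ⟨fun J _ _ => hasLimitsOfShape_of_hasLimitsOfShape_createsLimitsOfShape U.forget⟩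
  have : HasFiniteColimits U.Algebra :=
    ⟨fun J _ _ => hasColimitsOfShape_of_hasColimitsOfShape_createsColimitsOfShape U.forget⟩
  have : PreservesFiniteColimits U.forget := ⟨fun J _ _ => inferInstance⟩
  have : PreservesFiniteLimits U.forget := ⟨fun J _ _ => inferInstance⟩
  have : ∀ {X Y : U.Algebra} (f : X ⟶ Y), IsIso (Abelian.coimageImageComparison f) := by
    intro X Y f
    let iso := Abelian.PreservesCoimageImageComparison.iso U.forget f
    have : IsIso (U.forget.map (Abelian.coimageImageComparison f)) := by
      rw [Arrow.isIso_iff_isIso_of_isIso iso.hom]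
      infer_instance
    exact isIso_of_reflects_iso _ U.forget
  exact Abelian.ofCoimageImageComparisonIsIso

/-- Modules over an exact colimit-preserving monad on a Grothendieck category form a Grothendieck
category. -/
instance isGrothendieckAbelian_algebra [IsGrothendieckAbelian.{v} C]
    [PreservesColimits U.toFunctor] : IsGrothendieckAbelian.{v} U.Algebra := by
  have h1 : HasFilteredColimitsOfSize.{v, v} U.Algebra :=
    ⟨fun J _ _ => hasColimitsOfShape_of_hasColimitsOfShape_createsColimitsOfShape U.forget⟩
  have h2 : PreservesFiniteLimits U.forget := ⟨fun J _ _ => inferInstance⟩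
  have h3 : ReflectsFiniteLimits U.forget := ⟨fun J _ _ => inferInstance⟩
  have h4 : AB5OfSize.{v, v} U.Algebra :=
    ⟨fun J _ _ => HasExactColimitsOfShape.domain_of_functor J U.forget⟩
  have h5 : HasSeparator U.Algebra := by
    refine ⟨U.free.obj (separator C), ?_⟩
    rw [isSeparator_def]
    intro X Y f g h
    apply U.forget.map_injective
    apply (isSeparator_def _).1 (isSeparator_separator C)
    intro k
    have := congrArg (U.adj.homEquiv _ _) (h ((U.adj.homEquiv _ _).symm k))
    simpa [Adjunction.homEquiv_naturality_right] using this
  exact { }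

end EilenbergMoore

section Derivations

variable {C : Type u} [Category.{v} C] [Preadditive C]

/-- A derivation on a monad `(U, θ, η)`: a natural transformation `δ : U ⟶ U` such that
`δ ∘ θ = θ ∘ (1 ∗ δ + δ ∗ 1)`. The components at `X` of `1 ∗ δ` and `δ ∗ 1` are `U(δ_X)` and
`δ_{U X}`. -/
structure MonadDerivation (U : CategoryTheory.Monad C) where
  /-- the underlying natural transformation -/
  δ : U.toFunctor ⟶ U.toFunctor
  leibniz : ∀ X : C,
    U.μ.app X ≫ δ.app X = (U.map (δ.app X) + δ.app (U.obj X)) ≫ U.μ.app X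

/-- A `δ`-derivation on a `U`-module `(M, f_M)`: a morphism `d : M ⟶ M` in the base category with
`d ∘ f_M = f_M ∘ (U d + δ_M)`. -/
def MonadDerivation.IsDerivationOn {U : CategoryTheory.Monad C} (δ : MonadDerivation U) (M : U.Algebra)
    (d : M.A ⟶ M.A) : Prop :=
  M.a ≫ d = (U.map d + δ.δ.app M.A) ≫ M.a

end Derivations

section Differential

variable {C : Type u} [Category.{v} C] [Abelian C] [IsGrothendieckAbelian.{v} C] {U : CategoryTheory.Monad C}
  [PreservesFiniteLimits U.toFunctor] [PreservesFiniteColimits U.toFunctor]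
  [PreservesColimits U.toFunctor]

/-- The subobject in `C` underlying a submodule of a `U`-module. -/
noncomputable def underlying {M : U.Algebra} (N : Subobject M) : Subobject M.A :=
  have : Mono N.arrow.f := inferInstanceAs (Mono (U.forget.map N.arrow))
  Subobject.mk N.arrow.f

/-- A torsion theory on the category of `U`-modules is differential (with respect to `δ`) if
`d(M_τ) ⊆ M_τ` for every module `M` and every `δ`-derivation `d` on `M`. Here `d(M_τ)` is the image
in `C` of the restriction of `d` to `M_τ`. -/
def TorsionTheory.IsDifferential (τ : TorsionTheory U.Algebra) (δ : MonadDerivation U) : Prop :=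
  ∀ (M : U.Algebra) (d : M.A ⟶ M.A), δ.IsDerivationOn M d →
    imageSubobject ((underlying (τ.torsionSubobject M)).arrow ≫ d) ≤
      underlying (τ.torsionSubobject M)

end Differential

end EMTorsion

/-!
For a module `M` over the monad, let `i : A ⟶ M` be its torsion part and `p : M ⟶ B` the
torsion-free quotient. A derivation `d` on `M` is not linear, but its defect of linearity
`U M ⟶ M` is `δ_M` followed by the action, and by naturality of `δ` this carries `U A` into `A`.
Hence `i ≫ d ≫ p` is a morphism of modules from a torsion module to a torsion-free one
(`MonadDerivation.derivationHom`), so it vanishes, and `d` maps `A`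
into the kernel of `p`, which is `A`. It remains to identify `A` with the sum of all torsion
submodules (`TorsionTheory.torsionSubobject_eq_mk`), which again follows from the vanishing of
morphisms from torsion to torsion-free modules.
-/

namespace EMTorsion

/-- The torsion part in any decomposition of `M` is the torsion subobject of `M`. -/
theorem TorsionTheory.torsionSubobject_eq_mk {D : Type u} [Category.{v} D] [Abelian D]
    [IsGrothendieckAbelian.{v} D] (τ : TorsionTheory D) {A M B : D} (i : A ⟶ M) (p : M ⟶ B)
    [Mono i] (w : i ≫ p = 0) (hA : τ.torsion A) (hB : τ.torsionFree B)
    (hS : (ShortComplex.mk i p w).ShortExact) :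
    τ.torsionSubobject M = Subobject.mk i := by
  have := τ.torsion_iso
  refine le_antisymm (sSup_le fun N hN => ?_) (le_sSup ?_)
  · exact Subobject.le_mk_of_comm (hS.exact.lift N.arrow (τ.hom_eq_zero hN hB _))
      (hS.exact.lift_f _ _)
  · exact τ.torsion.prop_of_iso (Subobject.underlyingIso i).symm hA

variable {C : Type u} [Category.{v} C] [Abelian C] {U : CategoryTheory.Monad C}

/-- A derivation becomes linear once it is restricted to a submodule `i : A ⟶ M` and
composed with a morphism `p : M ⟶ B` that vanishes on this submodule. -/
def MonadDerivation.derivationHom [PreservesFiniteLimits U.toFunctor] (δ : MonadDerivation U)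
    {A M B : U.Algebra} (i : A ⟶ M) (p : M ⟶ B) (w : i ≫ p = 0) (d : M.A ⟶ M.A)
    (hd : δ.IsDerivationOn M d) : A ⟶ B where
  f := i.f ≫ d ≫ p.f
  h := by
    have hw : i.f ≫ p.f = 0 := congrArg Monad.Algebra.Hom.f w
    have hd' : M.a ≫ d = (U.map d + δ.δ.app M.A) ≫ M.a := hd
    have hdefect : U.map i.f ≫ δ.δ.app M.A ≫ M.a ≫ p.f = 0 := by
      rw [δ.δ.naturality_assoc i.f, i.h_assoc, hw, comp_zero, comp_zero]
    rw [← i.h_assoc, reassoc_of% hd']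
    simp only [Preadditive.add_comp, Preadditive.comp_add, Functor.map_comp, Category.assoc,
      p.h, hdefect, add_zero]

end EMTorsion

theorem theorem3p7 {C : Type u} [Category.{v} C] [Abelian C] [IsGrothendieckAbelian.{v} C]
    {Λ : Type v} (G : Λ → C)
    (hG_gen : (ObjectProperty.ofObj G).IsSeparating)
    (hG_fg : ∀ i, EMTorsion.IsFinitelyGenerated (G i))
    (hG_proj : ∀ i, Projective (G i))
    (U : CategoryTheory.Monad C)
    [PreservesFiniteLimits U.toFunctor] [PreservesFiniteColimits U.toFunctor]
    [PreservesColimits U.toFunctor]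
    (δ : EMTorsion.MonadDerivation U)
    (τ : EMTorsion.TorsionTheory U.Algebra) (hτ : τ.IsHereditary) :
    τ.IsDifferential δ := by
  intro M d hd
  obtain ⟨A, B, i, p, w, hA, hB, hS⟩ := τ.exists_shortExact M
  have : Mono i := hS.mono_f
  have hT := τ.torsionSubobject_eq_mk i p w hA hB hS
  have : Mono i.f := inferInstanceAs (Mono (U.forget.map i))
  have hu : EMTorsion.underlying (τ.torsionSubobject M) = Subobject.mk i.f := by
    have : Mono (τ.torsionSubobject M).arrow.f :=
      inferInstanceAs (Mono (U.forget.map (τ.torsionSubobject M).arrow))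
    let e := Subobject.isoOfEqMk _ i hT
    have he : e.hom ≫ i = (τ.torsionSubobject M).arrow := Subobject.ofLEMk_comp _
    exact Subobject.mk_eq_mk_of_comm _ _ (U.forget.mapIso e) (congrArg Monad.Algebra.Hom.f he)
  have : PreservesFiniteLimits U.forget := ⟨fun J _ _ => inferInstance⟩
  have : PreservesFiniteColimits U.forget := ⟨fun J _ _ => inferInstance⟩
  -- the forgetful functor is exact, so `i.f` is a kernel of `p.f` in the base category
  have hex := hS.map_of_exact U.forget
  have : Mono ((ShortComplex.mk i p w).map U.forget).f := hex.mono_f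
  have hz : (i.f ≫ d) ≫ p.f = 0 := by
    rw [Category.assoc]
    exact congrArg Monad.Algebra.Hom.f (τ.hom_eq_zero hA hB (δ.derivationHom i p w d hd))
  obtain ⟨l, hl⟩ : ∃ l : A.A ⟶ A.A, l ≫ i.f = i.f ≫ d :=
    ⟨hex.exact.lift (i.f ≫ d) hz, hex.exact.lift_f _ _⟩
  let e := Subobject.isoOfEqMk _ i.f hu
  have he : e.hom ≫ i.f = (EMTorsion.underlying (τ.torsionSubobject M)).arrow :=
    Subobject.ofLEMk_comp _
  refine imageSubobject_le _ (e.hom ≫ l ≫ e.inv) ?_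
  simp only [← he, Category.assoc, e.inv_hom_id_assoc, hl]
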